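/- Let $\mathbb{X},\mathbb{Y}$ be countable alphabets, let $\mathbb{X}^{\mathbb{Z}},\mathbb{Y}^{\mathbb{Z}}$ carry the product $\sigma$-algebras (of the discrete ones), and let $T(x)=(x_{i+1})_{i\in\mathbb{Z}}$ denote the shift on either space. A probability measure $\mu$ is called asymptotically mean stationary (AMS) if the limit $$\bar\mu(A)=\lim_{n\to\infty}\frac1n\sum_{i=0}^{n-1}\mu(T^{-i}A)$$ exists for every measurable set $A$; the set function $\bar\mu$ is its stationary mean. Put $$H_{\bar\mu}(n)=-\sum_{u\in\mathbb{X}^n}\bar\mu([u])\log\bar\mu([u])\in[0,\infty],\qquad [u]=\{x: x_1\cdots x_n=u\},$$ and similarly for $\mathbb{Y}$. Let $\mu$ be an AMS probability measure on $\mathbb{X}^{\mathbb{Z}}$, let $L\ge 1$, and let $f:\mathbb{X}\to\mathbb{Y}^L$ be a prefix-free fixed-length code (that is, $f$ is injective and no codeword is a proper prefix of a codeword). Let $$f^{\mathbb{Z}}(x)=\dots f(x_{-1})f(x_0)\,\mathbf{.}\,f(x_1)f(x_2)\dots,$$ where the dot separates the positions $0$ and $1$, and let $\nu=\mu\circ(f^{\mathbb{Z}})^{-1}$.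 Then $\nu$ is AMS, and for every $n\ge 0$ $$\left|H_{\bar\nu}(nL)-H_{\bar\mu}(n)\right|\le H_{\bar\mu}(2)+\log L .$$ Here the entropies may be infinite and the inequality is understood in $[0,\infty]$ as the pair of bounds $H_{\bar\nu}(nL)\le H_{\bar\mu}(n)+H_{\bar\mu}(2)+\log L$ and $H_{\bar\mu}(n)\le H_{\bar\nu}(nL)+H_{\bar\mu}(2)+\log L$; moreover, if $H_{\bar\mu}(2)<\infty$, then $H_{\bar\mu}(n)$ and $H_{\bar\nu}(nL)$ are finite for all $n$. -/

import Mathlib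

open Filter MeasureTheory
open scoped ENNReal Topology

noncomputable section

namespace BlockCoding

/-- The shift `(T x)_i = x_{i+1}` on two-sided sequences. -/
def shift {A : Type*} (x : ℤ → A) : ℤ → A := fun i => x (i + 1)

/-- The cylinder set `[u] = {x | x_1 x_2 ... x_n = u}` of a string `u = u_1 ... u_n`
(the first letter of the string is `u 0`). -/
def cylinder {A : Type*} {n : ℕ} (u : Fin n → A) : Set (ℤ → A) :=
  {x | ∀ j : Fin n, x ((j : ℤ) + 1) = u j}

/-- The Cesàro averages `(1/n) ∑_{i<n} μ(T^{-i} S)`. -/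
def cesaroMean {A : Type*} [MeasurableSpace A] (μ : Measure (ℤ → A))
    (S : Set (ℤ → A)) (n : ℕ) : ℝ :=
  (1 / (n : ℝ)) * ∑ i ∈ Finset.range n, μ.real (shift^[i] ⁻¹' S)

/-- `μ` is asymptotically mean stationary: the Cesàro averages converge on every measurable set. -/
def IsAMS {A : Type*} [MeasurableSpace A] (μ : Measure (ℤ → A)) : Prop :=
  ∀ S : Set (ℤ → A), MeasurableSet S → ∃ a : ℝ, Tendsto (cesaroMean μ S) atTop (𝓝 a)

/-- The stationary mean of `μ`, the set function of the limits of the Cesàro averages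
(meaningful on measurable sets when `μ` is asymptotically mean stationary). -/
def stationaryMean {A : Type*} [MeasurableSpace A] (μ : Measure (ℤ → A))
    (S : Set (ℤ → A)) : ℝ :=
  limUnder atTop (cesaroMean μ S)

theorem IsAMS.tendsto_stationaryMean {A : Type*} [MeasurableSpace A] {μ : Measure (ℤ → A)}
    (h : IsAMS μ) {S : Set (ℤ → A)} (hS : MeasurableSet S) :
    Tendsto (cesaroMean μ S) atTop (𝓝 (stationaryMean μ S)) :=
  tendsto_nhds_limUnder (h S hS)

/-- The block entropy `H_m(n) = - ∑_{u ∈ A^n} m([u]) log m([u])` (natural logarithm), with values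
in `[0, ∞]`, of a set function `m` whose values on cylinder sets lie in `[0, 1]`. -/
def blockEntropy {A : Type*} (m : Set (ℤ → A) → ℝ) (n : ℕ) : ℝ≥0∞ :=
  ∑' u : Fin n → A, ENNReal.ofReal (-(m (cylinder u) * Real.log (m (cylinder u))))

/-- No string of the set is a proper prefix of a string of the set. -/
def PrefixFreeSet {B : Type*} (W : Set (List B)) : Prop :=
  ∀ w ∈ W, ∀ z ∈ W, ∀ s : List B, s ≠ [] → w ≠ z ++ s

/-- A coding function is prefix-free if it is injective and its image is prefix-free. -/
def PrefixFreeCode {A B : Type*} (f : A → List B) : Prop :=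
  Function.Injective f ∧ PrefixFreeSet (Set.range f)

/-- The extension `f^ℤ(x) = ... f(x_{-1}) f(x_0) . f(x_1) f(x_2) ...` of a fixed-length code
`f : A → B^L`: the word `f(x_{k+1})` occupies the positions `kL+1, ..., kL+L`
(the dot stands between the positions `0` and `1`). -/
def extension {A B : Type*} {L : ℕ} [NeZero L] (f : A → Fin L → B) (x : ℤ → A) : ℤ → B :=
  fun i => f (x ((i - 1) / (L : ℤ) + 1)) (Fin.ofNat L ((i - 1) % (L : ℤ)).toNat)

theorem extension_apply {A B : Type*} {L : ℕ} [NeZero L] (f : A → Fin L → B) (x : ℤ → A)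
    (k : ℤ) (j : Fin L) : extension f x (k * L + (j + 1)) = f (x (k + 1)) j := by
  have hj : ((j : ℕ) : ℤ) < L := by exact_mod_cast j.isLt
  have hL : (L : ℤ) ≠ 0 := by exact_mod_cast NeZero.ne L
  have e : k * (L : ℤ) + ((j : ℤ) + 1) - 1 = (j : ℤ) + k * L := by ring
  have h1 : ((j : ℤ) + k * L) / (L : ℤ) = k := by
    rw [Int.add_mul_ediv_right _ _ hL, Int.ediv_eq_zero_of_lt (by positivity) hj, zero_add]
  have h2 : ((j : ℤ) + k * L) % (L : ℤ) = j := by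
    rw [Int.add_mul_emod_self_right, Int.emod_eq_of_lt (by positivity) hj]
  have h3 : Fin.ofNat L (j : ℕ) = j := by
    apply Fin.ext
    simp [Fin.ofNat, Nat.mod_eq_of_lt j.isLt]
  simp only [extension, e, h1, h2, Int.toNat_natCast, h3]

theorem measurable_extension {A B : Type*} [MeasurableSpace A] [DiscreteMeasurableSpace A]
    [MeasurableSpace B] {L : ℕ} [NeZero L] (f : A → Fin L → B) :
    Measurable (extension f) := by
  refine measurable_pi_lambda _ fun i => ?_
  exact (Measurable.of_discrete (f := fun a => f a (Fin.ofNat L ((i - 1) % (L : ℤ)).toNat))).comp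
    (measurable_pi_apply _)

end BlockCoding

end

/-! By Nikodym's convergence theorem the stationary mean of an AMS measure is a shift-invariant
probability measure, so Shannon's inequalities apply to it. Since `extension f` turns one shift of
the source into `L` shifts of the code, `ν` is AMS, and its mean is the average over phases `j < L`
of the laws of the encoded sequence shifted by `j`, with the source drawn from the mean of `μ`.

The law of an `n * L`-block under the mean of `ν` is thus a mixture of `L` phase laws. Its entropy
is at least the average of their entropies, and at most that average plus `log L`. A window at phase
`j` is a function of `x_1 ... x_{n+1}`, and together with `x_1` it determines `x_1 ... x_n`. Each
phase therefore costs at most one letter, whose entropy is bounded by that of a 2-block. -/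

namespace BlockCoding

/-! ### Nikodym's theorem by Baire category -/

/-- Nikodym's convergence theorem on `ℕ`: a setwise limit of summable sequences is countably
additive. -/
theorem hasSum_of_tendsto_tsum_indicator (a : ℕ → ℕ → ℝ) (ha : ∀ n, Summable (a n))
    (c : Set ℕ → ℝ)
    (hc : ∀ S, Tendsto (fun n => ∑' i, S.indicator (a n) i) atTop (𝓝 (c S))) :
    HasSum (fun i => c {i}) (c Set.univ) := by
  have hfin : ∀ J : Finset ℕ, ∀ n, ∑' i, (J : Set ℕ).indicator (a n) i = ∑ i ∈ J, a n i := by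
    intro J n
    rw [tsum_eq_sum (s := J)]
    · exact Finset.sum_congr rfl fun i hi => by simp [hi]
    · intro i hi
      simp [hi]
  have hcfin : ∀ J : Finset ℕ, c J = ∑ i ∈ J, c {i} := by
    intro J
    refine tendsto_nhds_unique (hc J) ?_
    simp only [hfin]
    refine tendsto_finsetSum _ fun i _ => ?_
    have := hc {i}
    have h1 : ∀ n, ∑' k, ({i} : Set ℕ).indicator (a n) k = a n i := by
      intro n
      simp
    simpa only [h1] using this
  have hadd : ∀ (S S' : Set ℕ), Disjoint S S' → ∀ n, ∑' i, (S ∪ S').indicator (a n) i =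
      ∑' i, S.indicator (a n) i + ∑' i, S'.indicator (a n) i := by
    intro S S' h n
    rw [Set.indicator_union_of_disjoint h,
      ((ha n).indicator S).tsum_add ((ha n).indicator S')]
  rw [HasSum, SummationFilter.unconditional_filter, Metric.tendsto_atTop]
  intro ε hε
  -- Subsets of `ℕ` are points of the Cantor space. The closed sets `F N` cover it, so by Baire some
  -- `F N` contains a cylinder, fixed by finitely many coordinates `I`.
  let F : ℕ → Set (ℕ → Bool) := fun N => {s | ∀ n ≥ N,
    |∑' i, {i | s i = true}.indicator (a n) i - ∑' i, {i | s i = true}.indicator (a N) i| ≤ ε / 8}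
  have hcont : ∀ n, Continuous fun s : ℕ → Bool => ∑' i, {i | s i = true}.indicator (a n) i := by
    intro n
    refine continuous_tsum (u := fun i => ‖a n i‖) (fun i => ?_) (ha n).norm fun i s => ?_
    · have : (fun s : ℕ → Bool => {i | s i = true}.indicator (a n) i) =
          (fun b : Bool => if b = true then a n i else 0) ∘ fun s => s i := by
        ext s
        simp [Set.indicator_apply]
      rw [this]
      exact continuous_of_discreteTopology.comp (continuous_apply i)
    · exact norm_indicator_le_norm_self _ _
  have hF : ∀ N, IsClosed (F N) := by
    intro N
    simp only [F, Set.ofPred_forall]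
    refine isClosed_iInter fun n => isClosed_iInter fun _ => ?_
    exact isClosed_le ((hcont n).sub (hcont N)).abs continuous_const
  have hU : ⋃ N, F N = Set.univ := by
    refine Set.eq_univ_of_forall fun s => ?_
    obtain ⟨N, hN⟩ := Metric.cauchySeq_iff'.1 (hc {i | s i = true}).cauchySeq (ε / 8) (by positivity)
    exact Set.mem_iUnion.2 ⟨N, fun n hn => (hN n hn).le⟩
  obtain ⟨N, s₀, hs₀⟩ := nonempty_interior_of_iUnion_of_closed hF hU
  obtain ⟨I, u, hu, hIu⟩ := isOpen_pi_iff.1 isOpen_interior s₀ hs₀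
  have hsmall : ∀ S : Set ℕ, Disjoint (I : Set ℕ) S → ∀ n ≥ N,
      |∑' i, S.indicator (a n) i - ∑' i, S.indicator (a N) i| ≤ ε / 4 := by
    classical
    intro S hS n hn
    -- `R ∪ S'` agrees with `s₀` on `I`, hence lies in `F N`. Comparing `R ∪ S` with `R` isolates
    -- `S` at the cost of twice `ε / 8`.
    set R : Set ℕ := {i | i ∈ I ∧ s₀ i = true} with hR
    have mem : ∀ S' : Set ℕ, Disjoint (I : Set ℕ) S' →
        |∑' i, (R ∪ S').indicator (a n) i - ∑' i, (R ∪ S').indicator (a N) i| ≤ ε / 8 := by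
      intro S' hS'
      have : (fun i => decide (i ∈ R ∪ S')) ∈ F N := by
        refine interior_subset (hIu fun i hi => ?_)
        have h2 : i ∉ S' := Set.disjoint_left.1 hS' hi
        have h3 : decide (i ∈ R ∪ S') = s₀ i := by
          have hi' : i ∈ I := hi
          rw [Bool.eq_iff_iff]
          simp [hR, h2, hi']
        simpa only [h3] using (hu i hi).2
      simpa only [decide_eq_true_eq, Set.ofPred_mem_eq] using this n hn
    have h1 := mem S hS
    have h2 := mem ∅ (by simp)
    have hd : Disjoint R S := hS.mono_left fun i hi => hi.1
    rw [hadd R S hd, hadd R S hd] at h1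
    rw [Set.union_empty] at h2
    rw [abs_le] at *
    constructor <;> linarith [h1.1, h1.2, h2.1, h2.2]
  obtain ⟨J₁, hJ₁⟩ := Metric.tendsto_atTop.1
    (by simpa [HasSum] using (ha N).hasSum) (ε / 4) (by positivity)
  -- Containing `I` makes the tails outside `J` uniformly close to that of `a N`; containing `J₁`
  -- makes the tail of `a N` itself small.
  refine ⟨I ∪ J₁, fun J hJ => ?_⟩
  have hcompl : ∀ n, ∑' i, (Set.univ : Set ℕ).indicator (a n) i - ∑' i, (J : Set ℕ).indicator (a n) i
      = ∑' i, ((J : Set ℕ)ᶜ).indicator (a n) i := by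
    intro n
    rw [← Set.union_compl_self (J : Set ℕ), hadd _ _ disjoint_compl_right n]
    ring
  have hlim := ((hc Set.univ).sub (hc J)).abs
  simp only [hcompl] at hlim
  have hle : |c Set.univ - c J| ≤ ε / 2 := by
    refine le_of_tendsto hlim (eventually_atTop.2 ⟨N, fun n hn => ?_⟩)
    have h1 := hsmall (J : Set ℕ)ᶜ (by
      refine disjoint_compl_right.mono_left ?_
      exact_mod_cast Finset.subset_union_left.trans hJ) n hn
    have h2 := hJ₁ J (Finset.subset_union_right.trans hJ)
    rw [Real.dist_eq, abs_sub_comm] at h2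
    have h3 := hcompl N
    rw [hfin, Set.indicator_univ] at h3
    rw [h3] at h2
    rw [abs_le] at *
    rw [abs_lt] at h2
    constructor <;> linarith [h1.1, h1.2, h2.1, h2.2]
  rw [← hcfin, Real.dist_eq, abs_sub_comm]
  linarith

/-- Nikodym's convergence theorem for finite measures. -/
theorem hasSum_of_tendsto_measureReal {Ω : Type*} [MeasurableSpace Ω] (m : ℕ → Measure Ω)
    [∀ n, IsFiniteMeasure (m n)] (c : Set Ω → ℝ)
    (hc : ∀ S, MeasurableSet S → Tendsto (fun n => (m n).real S) atTop (𝓝 (c S)))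
    (A : ℕ → Set Ω) (hA : ∀ i, MeasurableSet (A i)) (hd : Pairwise (Function.onFun Disjoint A)) :
    HasSum (fun i => c (A i)) (c (⋃ i, A i)) := by
  -- Unions of the `A i` over index sets `S` transfer the problem to sequences on `ℕ`.
  have key : ∀ n, ∀ S : Set ℕ, HasSum (S.indicator fun i => (m n).real (A i))
      ((m n).real (⋃ i ∈ S, A i)) := by
    intro n S
    have hm : ∀ i, MeasurableSet (⋃ (_ : i ∈ S), A i) := fun i => MeasurableSet.iUnion fun _ => hA i
    have hd' : Pairwise (Function.onFun Disjoint fun i => ⋃ (_ : i ∈ S), A i) := fun i j hij =>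
      (hd hij).mono (Set.iUnion_subset fun _ => le_rfl) (Set.iUnion_subset fun _ => le_rfl)
    have h1 := measure_iUnion (μ := m n) hd' hm
    have h2 : HasSum (fun i => (m n (⋃ (_ : i ∈ S), A i)).toReal) ((m n).real (⋃ i ∈ S, A i)) := by
      rw [Measure.real, h1, ENNReal.tsum_toReal_eq fun i => measure_ne_top _ _]
      exact (ENNReal.summable_toReal (h1 ▸ measure_ne_top _ _)).hasSum
    convert h2 using 2 with i
    by_cases hi : i ∈ S <;> simp [hi, Measure.real]
  have := hasSum_of_tendsto_tsum_indicator (fun n i => (m n).real (A i))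
    (fun n => by simpa using (key n Set.univ).summable) (fun S => c (⋃ i ∈ S, A i))
    (fun S => by
      simp only [(key _ S).tsum_eq]
      exact hc _ (MeasurableSet.biUnion S.to_countable fun i _ => hA i))
  simpa using this

/-! ### The stationary mean as an invariant measure -/

theorem measurable_shift {A : Type*} [MeasurableSpace A] :
    Measurable (shift : (ℤ → A) → ℤ → A) :=
  measurable_pi_lambda _ fun i => measurable_pi_apply (i + 1)

section StationaryMean

variable {A : Type*} [MeasurableSpace A] {μ : Measure (ℤ → A)}

theorem stationaryMean_nonneg (h : IsAMS μ) {S : Set (ℤ → A)} (hS : MeasurableSet S) :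
    0 ≤ stationaryMean μ S :=
  ge_of_tendsto' (h.tendsto_stationaryMean hS) fun n => by unfold cesaroMean; positivity

theorem stationaryMean_empty : stationaryMean μ ∅ = 0 := by
  refine Tendsto.limUnder_eq ?_
  have : cesaroMean μ ∅ = fun _ => 0 := by ext n; simp [cesaroMean]
  rw [this]
  exact tendsto_const_nhds

variable [IsProbabilityMeasure μ]

theorem hasSum_stationaryMean (h : IsAMS μ) (S : ℕ → Set (ℤ → A)) (hS : ∀ i, MeasurableSet (S i))
    (hd : Pairwise (Function.onFun Disjoint S)) :
    HasSum (fun i => stationaryMean μ (S i)) (stationaryMean μ (⋃ i, S i)) := by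
  -- The Cesàro averages as measures; for `n = 0` this is the zero measure, so the `m n` are finite
  -- but not all probability measures.
  let m : ℕ → Measure (ℤ → A) := fun n =>
    ENNReal.ofReal (1 / (n : ℝ)) • ∑ i ∈ Finset.range n, μ.map (shift^[i])
  have hfin : ∀ i, IsFiniteMeasure (μ.map (shift^[i])) := fun i => inferInstance
  have : ∀ n, IsFiniteMeasure (m n) := fun n =>
    Measure.smul_finite _ ENNReal.ofReal_ne_top
  refine hasSum_of_tendsto_measureReal m _ (fun B hB => ?_) S hS hd
  convert h.tendsto_stationaryMean hB using 2 with n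
  simp only [m, cesaroMean, measureReal_ennreal_smul_apply]
  rw [ENNReal.toReal_ofReal (by positivity)]
  congr 1
  rw [Measure.real, Measure.finsetSum_apply, ENNReal.toReal_sum fun i _ => measure_ne_top _ _]
  refine Finset.sum_congr rfl fun i _ => ?_
  rw [Measure.map_apply (measurable_shift.iterate i) hB]
  rfl

theorem stationaryMean_univ : stationaryMean μ Set.univ = 1 := by
  refine Tendsto.limUnder_eq (tendsto_const_nhds.congr' ?_)
  filter_upwards [eventually_ne_atTop 0] with n hn
  have : (n : ℝ) ≠ 0 := by exact_mod_cast hn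
  simp [cesaroMean, this]

/-- The two sums of `n` terms telescope to a difference of two boundary terms, which vanishes after
division by `n`. -/
theorem stationaryMean_shift (h : IsAMS μ) {S : Set (ℤ → A)} (hS : MeasurableSet S) :
    stationaryMean μ (shift ⁻¹' S) = stationaryMean μ S := by
  refine tendsto_nhds_unique (h.tendsto_stationaryMean (measurable_shift hS)) ?_
  have h0 : Tendsto (fun n : ℕ => (1 / (n : ℝ)) * (μ.real (shift^[n] ⁻¹' S) - μ.real S))
      atTop (𝓝 0) := by
    refine tendsto_one_div_atTop_nhds_zero_nat.zero_mul_isBoundedUnder_le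
      (isBoundedUnder_of ⟨1, fun n => ?_⟩)
    rw [Function.comp_apply, Real.norm_eq_abs, abs_le]
    constructor <;> linarith [measureReal_nonneg (μ := μ) (s := S),
      measureReal_nonneg (μ := μ) (s := shift^[n] ⁻¹' S), measureReal_le_one (μ := μ) (s := S),
      measureReal_le_one (μ := μ) (s := shift^[n] ⁻¹' S)]
  have h1 := (h.tendsto_stationaryMean hS).add h0
  rw [add_zero] at h1
  refine h1.congr fun n => ?_
  simp only [cesaroMean]
  rw [← mul_add]
  congr 1
  have h2 := Finset.sum_range_succ (fun i => μ.real (shift^[i] ⁻¹' S)) n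
  rw [Finset.sum_range_succ'] at h2
  have h3 : ∀ i, shift^[i] ⁻¹' (shift ⁻¹' S) = shift^[i + 1] ⁻¹' S := fun i => by
    rw [← Set.preimage_comp, Function.iterate_succ']
  simp only [h3]
  simp only [Function.iterate_zero, Set.preimage_id] at h2
  linarith

/-- The stationary mean of an asymptotically mean stationary measure, as a measure. -/
noncomputable def meanMeasure (h : IsAMS μ) : Measure (ℤ → A) :=
  Measure.ofMeasurable (fun S _ => ENNReal.ofReal (stationaryMean μ S))
    (by simp [stationaryMean_empty])
    (fun S hS hd => by
      have := hasSum_stationaryMean h S hS hd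
      rw [← this.tsum_eq, ENNReal.ofReal_tsum_of_nonneg
        (fun i => stationaryMean_nonneg h (hS i)) this.summable])

theorem meanMeasure_apply (h : IsAMS μ) {S : Set (ℤ → A)} (hS : MeasurableSet S) :
    meanMeasure h S = ENNReal.ofReal (stationaryMean μ S) :=
  Measure.ofMeasurable_apply _ hS

theorem meanMeasure_real (h : IsAMS μ) {S : Set (ℤ → A)} (hS : MeasurableSet S) :
    (meanMeasure h).real S = stationaryMean μ S := by
  rw [Measure.real, meanMeasure_apply h hS, ENNReal.toReal_ofReal (stationaryMean_nonneg h hS)]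

instance (h : IsAMS μ) : IsProbabilityMeasure (meanMeasure h) :=
  ⟨by rw [meanMeasure_apply h .univ, stationaryMean_univ, ENNReal.ofReal_one]⟩

theorem measurePreserving_shift (h : IsAMS μ) :
    MeasurePreserving shift (meanMeasure h) (meanMeasure h) :=
  ⟨measurable_shift, Measure.ext fun S hS => by
    rw [Measure.map_apply measurable_shift hS, meanMeasure_apply h (measurable_shift hS),
      meanMeasure_apply h hS, stationaryMean_shift h hS]⟩

end StationaryMean

/-! ### Shannon entropy with values in `[0, ∞]` -/

section Entropy

variable {Ω E F G : Type*} [MeasurableSpace Ω] {m : Measure Ω}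

/-- The Shannon entropy of a random variable with countably many values. -/
noncomputable def entropy (m : Measure Ω) (U : Ω → E) : ℝ≥0∞ :=
  ∑' e, ENNReal.ofReal (Real.negMulLog (m.real (U ⁻¹' {e})))

/-- The information content of the outcome of a random variable. -/
noncomputable def information (m : Measure Ω) (U : Ω → E) (e : E) : ℝ≥0∞ :=
  ENNReal.ofReal (-Real.log (m.real (U ⁻¹' {e})))

theorem entropy_comp {Ω' : Type*} [MeasurableSpace Ω'] {m' : Measure Ω'} {T : Ω → Ω'}
    (hT : MeasurePreserving T m m') (U : Ω' → E) (hU : ∀ e, MeasurableSet (U ⁻¹' {e})) :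
    entropy m (U ∘ T) = entropy m' U := by
  simp only [entropy, Set.preimage_comp, Measure.real,
    hT.measure_preimage (hU _).nullMeasurableSet]

variable [Countable E] [MeasurableSpace E] [DiscreteMeasurableSpace E]
  [Countable F] [MeasurableSpace F] [DiscreteMeasurableSpace F]
  [Countable G] [MeasurableSpace G] [DiscreteMeasurableSpace G]

theorem lintegral_comp_countable {U : Ω → E} (hU : Measurable U) (g : E → ℝ≥0∞) :
    ∫⁻ ω, g (U ω) ∂m = ∑' e, g e * m (U ⁻¹' {e}) := by
  rw [← lintegral_map (Measurable.of_discrete (f := g)) hU, lintegral_countable']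
  simp only [Measure.map_apply hU (MeasurableSet.singleton _)]

/-- Excludes the outcomes where the convention `Real.log 0 = 0` would spoil comparisons of
information. -/
theorem ae_measure_fibre_ne_zero {U : Ω → E} (hU : Measurable U) :
    ∀ᵐ ω ∂m, m (U ⁻¹' {U ω}) ≠ 0 := by
  refine ae_of_ae_map hU.aemeasurable (p := fun e => m (U ⁻¹' {e}) ≠ 0) ?_
  rw [ae_iff_of_countable]
  intro e
  rw [Measure.map_apply hU (MeasurableSet.singleton _)]
  exact id

variable [IsProbabilityMeasure m]

theorem tsum_measure_fibre {U : Ω → E} (hU : Measurable U) : ∑' e, m (U ⁻¹' {e}) = 1 := by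
  simpa using (lintegral_comp_countable (m := m) hU fun _ => 1).symm

/-- As an expectation of information, entropy can be compared pointwise almost everywhere, even
between variables with different ranges. -/
theorem entropy_eq_lintegral {U : Ω → E} (hU : Measurable U) :
    entropy m U = ∫⁻ ω, information m U (U ω) ∂m := by
  rw [lintegral_comp_countable hU, entropy]
  refine tsum_congr fun e => ?_
  rw [information, ← ofReal_measureReal (μ := m), ← ENNReal.ofReal_mul' measureReal_nonneg,
    Real.negMulLog]
  congr 1
  ring

/-- The entropy of a function of a random variable is at most that of the variable. -/
theorem entropy_le_of_determined {U : Ω → E} {V : Ω → F} (hU : Measurable U) (hV : Measurable V)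
    (h : ∀ ω ω', V ω = V ω' → U ω = U ω') : entropy m U ≤ entropy m V := by
  rw [entropy_eq_lintegral hU, entropy_eq_lintegral hV]
  refine lintegral_mono_ae ?_
  filter_upwards [ae_measure_fibre_ne_zero (m := m) hV] with ω hω
  refine ENNReal.ofReal_le_ofReal (neg_le_neg (Real.log_le_log ?_ (measureReal_mono ?_)))
  · exact ENNReal.toReal_pos hω (measure_ne_top _ _)
  · exact fun ω' hω' => h _ _ hω'

/-- This is `log t ≤ t - 1` at `t = a * b / p`, arranged so that for probabilities all summands are
nonnegative and it passes to `ℝ≥0∞`. -/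
theorem add_log_div_le {p a b : ℝ} (hp : 0 < p) (ha : 0 < a) (hb : 0 < b) :
    -Real.log p + 1 ≤ -Real.log a + -Real.log b + a * b / p := by
  have := Real.log_le_sub_one_of_pos (show 0 < a * b / p by positivity)
  rw [Real.log_div (by positivity) hp.ne', Real.log_mul ha.ne' hb.ne'] at this
  linarith

/-- Mutual information is nonnegative, phrased without subtraction because the entropies may be
infinite: `1` is added on the left, the likelihood ratio `r` of mean at most `1` on the right, and
the finite `1` is cancelled. -/
theorem entropy_prodMk_le {U : Ω → E} {V : Ω → F} (hU : Measurable U) (hV : Measurable V) :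
    entropy m (fun ω => (U ω, V ω)) ≤ entropy m U + entropy m V := by
  have hW : Measurable fun ω => (U ω, V ω) := hU.prodMk hV
  have hpre : ∀ e : E × F, (fun ω => (U ω, V ω)) ⁻¹' {e} ⊆ U ⁻¹' {e.1} ∩ V ⁻¹' {e.2} := by
    rintro e ω rfl
    exact ⟨rfl, rfl⟩
  rw [entropy_eq_lintegral hU, entropy_eq_lintegral hV, entropy_eq_lintegral hW,
    ← lintegral_add_left (f := fun ω => information m U (U ω))
      ((Measurable.of_discrete (f := information m U)).comp hU)]
  let r : E × F → ℝ≥0∞ := fun e =>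
    m (U ⁻¹' {e.1}) * m (V ⁻¹' {e.2}) / m ((fun ω => (U ω, V ω)) ⁻¹' {e})
  have hr : ∫⁻ ω, r (U ω, V ω) ∂m ≤ 1 := by
    rw [lintegral_comp_countable hW]
    calc ∑' e, r e * m ((fun ω => (U ω, V ω)) ⁻¹' {e})
        ≤ ∑' e : E × F, m (U ⁻¹' {e.1}) * m (V ⁻¹' {e.2}) := by
          refine ENNReal.tsum_le_tsum fun e => ?_
          rw [mul_comm]
          exact ENNReal.mul_div_le
      _ = 1 := by
          rw [ENNReal.tsum_prod (f := fun a b => m (U ⁻¹' {a}) * m (V ⁻¹' {b}))]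
          simp only [ENNReal.tsum_mul_left, tsum_measure_fibre hV, mul_one, tsum_measure_fibre hU]
  have key : ∫⁻ ω, information m (fun ω => (U ω, V ω)) (U ω, V ω) + 1 ∂m ≤
      ∫⁻ ω, (information m U (U ω) + information m V (V ω)) + r (U ω, V ω) ∂m := by
    refine lintegral_mono_ae ?_
    filter_upwards [ae_measure_fibre_ne_zero (m := m) hW] with ω hω
    have hp : 0 < m.real ((fun ω => (U ω, V ω)) ⁻¹' {(U ω, V ω)}) :=
      ENNReal.toReal_pos hω (measure_ne_top _ _)
    have ha : 0 < m.real (U ⁻¹' {U ω}) :=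
      hp.trans_le (measureReal_mono fun ω' hω' => (hpre _ hω').1)
    have hb : 0 < m.real (V ⁻¹' {V ω}) :=
      hp.trans_le (measureReal_mono fun ω' hω' => (hpre _ hω').2)
    have hlog : ∀ S : Set Ω, 0 ≤ -Real.log (m.real S) := fun S =>
      neg_nonneg.2 (Real.log_nonpos measureReal_nonneg measureReal_le_one)
    have hrr : r (U ω, V ω) = ENNReal.ofReal (m.real (U ⁻¹' {U ω}) * m.real (V ⁻¹' {V ω}) /
        m.real ((fun ω => (U ω, V ω)) ⁻¹' {(U ω, V ω)})) := by
      rw [ENNReal.ofReal_div_of_pos hp, ENNReal.ofReal_mul measureReal_nonneg,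
        ofReal_measureReal, ofReal_measureReal, ofReal_measureReal]
    rw [hrr]
    simp only [information]
    rw [← ENNReal.ofReal_one, ← ENNReal.ofReal_add (hlog _) zero_le_one,
      ← ENNReal.ofReal_add (hlog _) (hlog _),
      ← ENNReal.ofReal_add (add_nonneg (hlog _) (hlog _)) (by positivity)]
    exact ENNReal.ofReal_le_ofReal (add_log_div_le hp ha hb)
  rw [lintegral_add_right _ measurable_const,
    lintegral_add_right (g := fun ω => r (U ω, V ω)) _
      ((Measurable.of_discrete (f := r)).comp hW)] at key
  simp only [lintegral_const, measure_univ, mul_one] at key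
  exact (ENNReal.add_le_add_iff_right ENNReal.one_ne_top).1 (key.trans (by gcongr))

theorem entropy_le_add_of_determined {W : Ω → G} {U : Ω → E} {V : Ω → F} (hW : Measurable W)
    (hU : Measurable U) (hV : Measurable V)
    (h : ∀ ω ω', U ω = U ω' → V ω = V ω' → W ω = W ω') :
    entropy m W ≤ entropy m U + entropy m V :=
  (entropy_le_of_determined hW (hU.prodMk hV) fun ω ω' h' =>
    h ω ω' (Prod.ext_iff.1 h').1 (Prod.ext_iff.1 h').2).trans (entropy_prodMk_le hU hV)

end Entropy

/-! ### Entropy of mixtures -/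

section Mixture

theorem mean_negMulLog_le {L : ℕ} (hL : L ≠ 0) (p : ℕ → ℝ) (h0 : ∀ j, 0 ≤ p j) :
    (1 / (L : ℝ)) * ∑ j ∈ Finset.range L, Real.negMulLog (p j) ≤
      Real.negMulLog ((1 / (L : ℝ)) * ∑ j ∈ Finset.range L, p j) := by
  have hL' : (L : ℝ) ≠ 0 := by exact_mod_cast hL
  have := Real.concaveOn_negMulLog.le_map_sum (t := Finset.range L) (w := fun _ => 1 / (L : ℝ))
    (p := p) (fun _ _ => by positivity) (by simp [hL']) (fun j _ => h0 j)
  simpa only [smul_eq_mul, ← Finset.mul_sum] using this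

/-- The mean is at least `p j / L` for each `j`, so its negative logarithm exceeds that of a
positive `p j` by at most `log L`. -/
theorem negMulLog_mean_le {L : ℕ} (p : ℕ → ℝ) (h0 : ∀ j, 0 ≤ p j) :
    Real.negMulLog ((1 / (L : ℝ)) * ∑ j ∈ Finset.range L, p j) ≤
      (1 / (L : ℝ)) * ∑ j ∈ Finset.range L, (Real.negMulLog (p j) + p j * Real.log L) := by
  rcases eq_or_ne L 0 with rfl | hL
  · simp
  have hL' : 0 < (L : ℝ) := by exact_mod_cast Nat.pos_of_ne_zero hL
  rw [Real.negMulLog, ← neg_mul_eq_neg_mul, mul_assoc, ← mul_neg]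
  refine mul_le_mul_of_nonneg_left ?_ (by positivity)
  rw [Finset.sum_mul, ← Finset.sum_neg_distrib]
  refine Finset.sum_le_sum fun j hj => ?_
  rcases (h0 j).eq_or_lt with h | h
  · simp [← h]
  have hle : Real.log ((1 / (L : ℝ)) * p j) ≤
      Real.log ((1 / (L : ℝ)) * ∑ j ∈ Finset.range L, p j) := by
    refine Real.log_le_log (by positivity) (mul_le_mul_of_nonneg_left ?_ (by positivity))
    exact Finset.single_le_sum (fun i _ => h0 i) hj
  rw [Real.log_mul (by positivity) h.ne', one_div, Real.log_inv] at hle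
  have := mul_le_mul_of_nonneg_left hle h.le
  rw [Real.negMulLog]
  rw [one_div]
  linarith

variable {E : Type*} {L : ℕ} {p : ℕ → E → ℝ} {q : E → ℝ}

/-- The entropy of a mixture exceeds the mean of the entropies by at most the logarithm of the
number of components. -/
theorem entropy_mean_le (h0 : ∀ j e, 0 ≤ p j e) (h1 : ∀ j e, p j e ≤ 1)
    (hp : ∀ j, ∑' e, ENNReal.ofReal (p j e) = 1)
    (hq : ∀ e, q e = (1 / (L : ℝ)) * ∑ j ∈ Finset.range L, p j e) :
    ∑' e, ENNReal.ofReal (Real.negMulLog (q e)) ≤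
      ENNReal.ofReal (1 / (L : ℝ)) * ∑ j ∈ Finset.range L,
        (∑' e, ENNReal.ofReal (Real.negMulLog (p j e)) + ENNReal.ofReal (Real.log L)) := by
  have h2 : ∀ j, ∑' e, ENNReal.ofReal (Real.negMulLog (p j e)) + ENNReal.ofReal (Real.log L) =
      ∑' e, ENNReal.ofReal (Real.negMulLog (p j e) + p j e * Real.log L) := by
    intro j
    nth_rw 1 [← one_mul (ENNReal.ofReal (Real.log L))]
    rw [← hp j, ← ENNReal.tsum_mul_right, ← ENNReal.tsum_add]
    refine tsum_congr fun e => ?_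
    rw [ENNReal.ofReal_add (Real.negMulLog_nonneg (h0 j e) (h1 j e))
      (mul_nonneg (h0 j e) (Real.log_natCast_nonneg L)), ENNReal.ofReal_mul (h0 j e)]
  simp only [h2]
  rw [← Summable.tsum_finsetSum fun j _ => ENNReal.summable, ← ENNReal.tsum_mul_left]
  refine ENNReal.tsum_le_tsum fun e => ?_
  rw [← ENNReal.ofReal_sum_of_nonneg fun j _ => add_nonneg
      (Real.negMulLog_nonneg (h0 j e) (h1 j e))
      (mul_nonneg (h0 j e) (Real.log_natCast_nonneg L)),
    ← ENNReal.ofReal_mul (by positivity), hq]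
  exact ENNReal.ofReal_le_ofReal (negMulLog_mean_le _ fun j => h0 j e)

variable [NeZero L]

/-- Entropy is concave. -/
theorem mean_entropy_le (h0 : ∀ j e, 0 ≤ p j e) (h1 : ∀ j e, p j e ≤ 1)
    (hq : ∀ e, q e = (1 / (L : ℝ)) * ∑ j ∈ Finset.range L, p j e) :
    ENNReal.ofReal (1 / (L : ℝ)) *
        ∑ j ∈ Finset.range L, ∑' e, ENNReal.ofReal (Real.negMulLog (p j e)) ≤
      ∑' e, ENNReal.ofReal (Real.negMulLog (q e)) := by
  rw [← Summable.tsum_finsetSum fun j _ => ENNReal.summable, ← ENNReal.tsum_mul_left]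
  refine ENNReal.tsum_le_tsum fun e => ?_
  rw [← ENNReal.ofReal_sum_of_nonneg fun j _ => Real.negMulLog_nonneg (h0 j e) (h1 j e),
    ← ENNReal.ofReal_mul (by positivity), hq]
  exact ENNReal.ofReal_le_ofReal (mean_negMulLog_le (NeZero.ne L) _ fun j => h0 j e)

theorem mean_le_of_forall_le {a : ℕ → ℝ≥0∞} {b : ℝ≥0∞} (h : ∀ j < L, a j ≤ b) :
    ENNReal.ofReal (1 / (L : ℝ)) * ∑ j ∈ Finset.range L, a j ≤ b := by
  have hL : (L : ℝ) ≠ 0 := by exact_mod_cast NeZero.ne L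
  calc _ ≤ ENNReal.ofReal (1 / (L : ℝ)) * ∑ j ∈ Finset.range L, b := by
        gcongr with j hj
        exact h j (Finset.mem_range.1 hj)
    _ = b := by
        rw [Finset.sum_const, Finset.card_range, nsmul_eq_mul, ← mul_assoc,
          ← ENNReal.ofReal_natCast, ← ENNReal.ofReal_mul (by positivity), one_div_mul_cancel hL,
          ENNReal.ofReal_one, one_mul]

theorem le_mean_of_forall_le {a : ℕ → ℝ≥0∞} {b : ℝ≥0∞} (h : ∀ j < L, b ≤ a j) :
    b ≤ ENNReal.ofReal (1 / (L : ℝ)) * ∑ j ∈ Finset.range L, a j := by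
  have hL : (L : ℝ) ≠ 0 := by exact_mod_cast NeZero.ne L
  calc b = ENNReal.ofReal (1 / (L : ℝ)) * ∑ j ∈ Finset.range L, b := by
        rw [Finset.sum_const, Finset.card_range, nsmul_eq_mul, ← mul_assoc,
          ← ENNReal.ofReal_natCast, ← ENNReal.ofReal_mul (by positivity), one_div_mul_cancel hL,
          ENNReal.ofReal_one, one_mul]
    _ ≤ _ := by
        gcongr with j hj
        exact h j (Finset.mem_range.1 hj)

end Mixture

/-! ### Cesàro averages along residue classes -/

theorem sum_range_mul_eq_sum_sum (a : ℕ → ℝ) (L q : ℕ) :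
    ∑ i ∈ Finset.range (q * L), a i =
      ∑ j ∈ Finset.range L, ∑ k ∈ Finset.range q, a (k * L + j) := by
  rw [Finset.sum_comm]
  induction q with
  | zero => simp
  | succ q ih => rw [Nat.succ_mul, Finset.sum_range_add, ih, Finset.sum_range_succ]

/-- If the Cesàro averages along all residue classes modulo `L` converge, so do the Cesàro
averages of the whole bounded sequence. -/
theorem tendsto_cesaro_of_residues {L : ℕ} (hL : L ≠ 0) (a : ℕ → ℝ) (h0 : ∀ i, 0 ≤ a i)
    (h1 : ∀ i, a i ≤ 1) (c : ℕ → ℝ)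
    (h : ∀ j < L, Tendsto (fun n : ℕ => (1 / (n : ℝ)) * ∑ k ∈ Finset.range n, a (k * L + j))
      atTop (𝓝 (c j))) :
    Tendsto (fun n : ℕ => (1 / (n : ℝ)) * ∑ i ∈ Finset.range n, a i) atTop
      (𝓝 ((1 / (L : ℝ)) * ∑ j ∈ Finset.range L, c j)) := by
  have hq : Tendsto (fun n : ℕ => n / L) atTop atTop := Nat.tendsto_div_const_atTop hL
  have hfrac : Tendsto (fun n : ℕ => ((n / L : ℕ) : ℝ) / n) atTop (𝓝 (1 / (L : ℝ))) := by
    have := (tendsto_nat_floor_mul_div_atTop (R := ℝ) (a := 1 / (L : ℝ)) (by positivity)).comp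
      tendsto_natCast_atTop_atTop
    refine this.congr fun n => ?_
    rw [Function.comp_apply, one_div_mul_eq_div, Nat.floor_div_eq_div]
  have hmain := hfrac.mul ((tendsto_finsetSum (Finset.range L) fun j hj =>
    h j (Finset.mem_range.1 hj)).comp hq)
  -- The incomplete last period has fewer than `L` terms, each at most `1`.
  have hrest : Tendsto (fun n : ℕ => (1 / (n : ℝ)) *
      ∑ i ∈ Finset.range (n % L), a (n / L * L + i)) atTop (𝓝 0) := by
    refine tendsto_one_div_atTop_nhds_zero_nat.zero_mul_isBoundedUnder_le
      (isBoundedUnder_of ⟨L, fun n => ?_⟩)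
    rw [Function.comp_apply, Real.norm_of_nonneg (Finset.sum_nonneg fun i _ => h0 _)]
    refine (Finset.sum_le_sum fun i _ => h1 _).trans ?_
    simpa using (Nat.mod_lt n (Nat.pos_of_ne_zero hL)).le
  have hsum := hmain.add hrest
  rw [add_zero] at hsum
  refine hsum.congr' ?_
  filter_upwards [hq.eventually (eventually_ne_atTop 0)] with n hn
  have hn' : ((n / L : ℕ) : ℝ) ≠ 0 := by exact_mod_cast hn
  have hsplit : ∑ i ∈ Finset.range n, a i = ∑ i ∈ Finset.range (n / L * L), a i +
      ∑ i ∈ Finset.range (n % L), a (n / L * L + i) := by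
    rw [← Finset.sum_range_add, Nat.div_add_mod']
  rw [hsplit, sum_range_mul_eq_sum_sum, mul_add]
  congr 1
  rw [Function.comp_apply, ← Finset.mul_sum, ← mul_assoc]
  congr 1
  field_simp

/-! ### Blocks of the encoded sequence and the AMS property -/

theorem iterate_shift_apply {A : Type*} (j : ℕ) (x : ℤ → A) (i : ℤ) :
    shift^[j] x i = x (i + j) := by
  induction j generalizing i with
  | zero => simp
  | succ j ih =>
    rw [Function.iterate_succ_apply', shift, ih]
    congr 1
    push_cast
    ring

/-- The block `x_1 ... x_n`. -/
def block {A : Type*} (n : ℕ) (x : ℤ → A) : Fin n → A := fun j => x ((j : ℤ) + 1)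

theorem cylinder_eq_preimage {A : Type*} {n : ℕ} (u : Fin n → A) :
    cylinder u = block n ⁻¹' {u} := by
  ext x
  simp [cylinder, block, funext_iff]

theorem measurable_block {A : Type*} [MeasurableSpace A] (n : ℕ) :
    Measurable (block n : (ℤ → A) → Fin n → A) :=
  measurable_pi_lambda _ fun _ => measurable_pi_apply _

section Extension

variable {X Y : Type*} {L : ℕ} [NeZero L] (f : X → Fin L → Y)

theorem extension_shift (x : ℤ → X) : extension f (shift x) = shift^[L] (extension f x) := by
  have hL : (L : ℤ) ≠ 0 := by exact_mod_cast NeZero.ne L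
  ext i
  rw [iterate_shift_apply]
  have e : i + (L : ℤ) - 1 = i - 1 + L := by ring
  have h1 : (i - 1 + (L : ℤ)) / L = (i - 1) / L + 1 := by
    simpa using Int.add_mul_ediv_right (i - 1) 1 hL
  simp only [extension, shift, e, h1, Int.add_emod_right]

theorem extension_iterate_shift (k : ℕ) (x : ℤ → X) :
    extension f (shift^[k] x) = shift^[k * L] (extension f x) := by
  induction k generalizing x with
  | zero => simp
  | succ k ih =>
    rw [Function.iterate_succ_apply, ih, extension_shift, ← Function.iterate_add_apply,
      Nat.succ_mul]

/-- The block of `n * L` letters at phase `j` of the encoded sequence. -/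
def codeBlock (n j : ℕ) (x : ℤ → X) : Fin (n * L) → Y :=
  block (n * L) (shift^[j] (extension f x))

theorem codeBlock_apply (n j : ℕ) (x : ℤ → X) (i : Fin (n * L)) :
    codeBlock f n j x i =
      f (x ((((i + j) / L : ℕ) : ℤ) + 1)) (Fin.ofNat L ((i + j) % L)) := by
  have e : ((i : ℕ) : ℤ) + 1 + (j : ℤ) - 1 = ((i + j : ℕ) : ℤ) := by push_cast; ring
  simp only [codeBlock, block, iterate_shift_apply, extension, e, ← Int.natCast_div,
    ← Int.natCast_mod, Int.toNat_natCast]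

/-- As `j < L`, the window ends before offset `(n + 1) * L`, so it meets only the codewords of `x_1,
..., x_{n+1}`. -/
theorem codeBlock_eq_of_block_eq {n j : ℕ} (hj : j < L) {x x' : ℤ → X}
    (h1 : block n x = block n x') (h2 : x ((n : ℤ) + 1) = x' ((n : ℤ) + 1)) :
    codeBlock f n j x = codeBlock f n j x' := by
  ext i
  rw [codeBlock_apply, codeBlock_apply]
  have hk : (i + j) / L ≤ n := by
    refine Nat.lt_succ_iff.1 ((Nat.div_lt_iff_lt_mul (NeZero.pos L)).2 ?_)
    rw [Nat.succ_mul]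
    omega
  congr 1
  rcases hk.lt_or_eq with hk | hk
  · rw [show x _ = x' _ from congrFun h1 ⟨_, hk⟩]
  · rw [hk, h2]

/-- The window contains the codewords of `x_2, ..., x_n` in full; only that of `x_1` may be
truncated, hence `h1`. -/
theorem block_eq_of_codeBlock_eq (hf : Function.Injective f) {n j : ℕ} (hj : j < L)
    {x x' : ℤ → X} (h1 : x 1 = x' 1) (h2 : codeBlock f n j x = codeBlock f n j x') :
    block n x = block n x' := by
  ext ⟨k, hk⟩
  simp only [block]
  rcases Nat.eq_zero_or_pos k with rfl | hk0
  · simpa using h1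
  refine hf (funext fun l => ?_)
  have hle : 1 * L ≤ k * L := Nat.mul_le_mul_right L hk0
  have hlt : (k + 1) * L ≤ n * L := Nat.mul_le_mul_right L hk
  rw [Nat.succ_mul] at hlt
  have hl := l.isLt
  -- The natural subtraction is not truncated, because `j < L ≤ k * L`.
  have := congrFun h2 ⟨k * L + l - j, by omega⟩
  rw [codeBlock_apply, codeBlock_apply] at this
  have e : k * L + l - j + j = l + k * L := by omega
  simpa only [e, Nat.add_mul_div_right _ _ (NeZero.pos L), Nat.div_eq_of_lt hl, zero_add,
    Nat.add_mul_mod_self_right, Nat.mod_eq_of_lt hl, Fin.ofNat_val_eq_self] using this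

variable [MeasurableSpace X] [DiscreteMeasurableSpace X] [MeasurableSpace Y]

theorem measurable_codeBlock (n j : ℕ) : Measurable (codeBlock f n j) :=
  (measurable_block _).comp ((measurable_shift.iterate j).comp (measurable_extension f))

variable {μ : Measure (ℤ → X)} [IsProbabilityMeasure μ]

/-- Shifting the code by `k * L + j` amounts to shifting the source by `k` and then the code by `j`,
so residue class `j` is a Cesàro average for `μ` of a fixed set. -/
theorem tendsto_cesaroMean_map_extension (hμ : IsAMS μ) {S : Set (ℤ → Y)} (hS : MeasurableSet S) :
    Tendsto (cesaroMean (μ.map (extension f)) S) atTop (𝓝 ((1 / (L : ℝ)) *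
      ∑ j ∈ Finset.range L, stationaryMean μ (extension f ⁻¹' (shift^[j] ⁻¹' S)))) := by
  have hpre : ∀ j, MeasurableSet (extension f ⁻¹' (shift^[j] ⁻¹' S)) := fun j =>
    measurable_extension f (measurable_shift.iterate j hS)
  have := tendsto_cesaro_of_residues (NeZero.ne L)
    (fun i => μ.real (extension f ⁻¹' (shift^[i] ⁻¹' S))) (fun _ => measureReal_nonneg)
    (fun _ => measureReal_le_one) (fun j => stationaryMean μ (extension f ⁻¹' (shift^[j] ⁻¹' S)))
    (fun j _ => by
      refine (hμ.tendsto_stationaryMean (hpre j)).congr fun n => ?_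
      simp only [cesaroMean]
      congr 1
      refine Finset.sum_congr rfl fun k _ => ?_
      congr 1
      ext x
      simp only [Set.mem_preimage, extension_iterate_shift, ← Function.iterate_add_apply]
      rw [add_comm])
  refine this.congr fun n => ?_
  simp only [cesaroMean]
  congr 1
  refine Finset.sum_congr rfl fun i _ => ?_
  rw [map_measureReal_apply (measurable_extension f) (measurable_shift.iterate i hS)]

theorem isAMS_map_extension (hμ : IsAMS μ) : IsAMS (μ.map (extension f)) :=
  fun _ hS => ⟨_, tendsto_cesaroMean_map_extension f hμ hS⟩

end Extension

/-! ### The two entropy bounds -/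

section BlockEntropy

theorem blockEntropy_zero {X : Type*} [MeasurableSpace X] (μ : Measure (ℤ → X))
    [IsProbabilityMeasure μ] : blockEntropy (stationaryMean μ) 0 = 0 := by
  have : ∀ u : Fin 0 → X, cylinder u = Set.univ := fun u => by simp [cylinder]
  simp [blockEntropy, this, stationaryMean_univ]

variable {X : Type*} [MeasurableSpace X] [DiscreteMeasurableSpace X]
  {μ : Measure (ℤ → X)} [IsProbabilityMeasure μ]

variable {Y : Type*} [Countable Y] [MeasurableSpace Y] [DiscreteMeasurableSpace Y]
  {L : ℕ} [NeZero L] {f : X → Fin L → Y}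

theorem stationaryMean_map_extension_cylinder (hμ : IsAMS μ) (n : ℕ) (w : Fin (n * L) → Y) :
    stationaryMean (μ.map (extension f)) (cylinder w) = (1 / (L : ℝ)) *
      ∑ j ∈ Finset.range L, (meanMeasure hμ).real (codeBlock f n j ⁻¹' {w}) := by
  have hw : MeasurableSet (cylinder w) := by
    rw [cylinder_eq_preimage]
    exact measurable_block _ (MeasurableSet.singleton w)
  rw [stationaryMean, (tendsto_cesaroMean_map_extension f hμ hw).limUnder_eq]
  congr 1
  refine Finset.sum_congr rfl fun j _ => ?_
  rw [meanMeasure_real hμ (measurable_codeBlock f n j (MeasurableSet.singleton w)),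
    cylinder_eq_preimage]
  rfl

variable [Countable X]

theorem blockEntropy_eq_entropy (hμ : IsAMS μ) (n : ℕ) :
    blockEntropy (stationaryMean μ) n = entropy (meanMeasure hμ) (block n) := by
  refine tsum_congr fun u => ?_
  rw [cylinder_eq_preimage, meanMeasure_real hμ (measurable_block n (MeasurableSet.singleton u)),
    Real.negMulLog, neg_mul]

/-- By stationarity every letter has the law of `x_1`, a coordinate of the 2-block. -/
theorem entropy_apply_le (hμ : IsAMS μ) (k : ℕ) :
    entropy (meanMeasure hμ) (fun x => x ((k : ℤ) + 1)) ≤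
      blockEntropy (stationaryMean μ) 2 := by
  have h := entropy_comp ((measurePreserving_shift hμ).iterate k) (fun x : ℤ → X => x 1)
    fun e => measurable_pi_apply _ (MeasurableSet.singleton e)
  have e : (fun x : ℤ → X => x ((k : ℤ) + 1)) = (fun x : ℤ → X => x 1) ∘ shift^[k] := by
    ext x
    rw [Function.comp_apply, iterate_shift_apply, add_comm]
  rw [e, h, blockEntropy_eq_entropy hμ]
  refine entropy_le_of_determined (measurable_pi_apply _) (measurable_block 2) fun x x' hx => ?_
  simpa [block] using congrFun hx 0

theorem blockEntropy_ne_top (hμ : IsAMS μ) (h2 : blockEntropy (stationaryMean μ) 2 ≠ ⊤) (n : ℕ) :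
    blockEntropy (stationaryMean μ) n ≠ ⊤ := by
  induction n with
  | zero => simp [blockEntropy_zero]
  | succ n ih =>
    refine ne_top_of_le_ne_top (ENNReal.add_ne_top.2 ⟨ih, h2⟩)
      (le_trans ?_ (add_le_add_right (entropy_apply_le hμ n) _))
    rw [blockEntropy_eq_entropy hμ, blockEntropy_eq_entropy hμ]
    refine entropy_le_add_of_determined (measurable_block _) (measurable_block _)
      (measurable_pi_apply _) fun x x' h h' => ?_
    ext ⟨k, hk⟩
    rcases (Nat.lt_succ_iff.1 hk).lt_or_eq with hk | rfl
    · exact congrFun h ⟨k, hk⟩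
    · exact h'

/-- Mixing the phases costs `log L`; in each phase the extra letter `x_{n+1}` costs the 2-block
entropy. -/
theorem blockEntropy_map_extension_le (hμ : IsAMS μ) (n : ℕ) :
    blockEntropy (stationaryMean (μ.map (extension f))) (n * L) ≤
      blockEntropy (stationaryMean μ) n +
        (blockEntropy (stationaryMean μ) 2 + ENNReal.ofReal (Real.log L)) := by
  refine le_trans (le_of_eq (tsum_congr fun w => ?_)) ((entropy_mean_le (L := L)
    (p := fun j w => (meanMeasure hμ).real (codeBlock f n j ⁻¹' {w}))
    (q := fun w => stationaryMean (μ.map (extension f)) (cylinder w))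
    (fun _ _ => measureReal_nonneg) (fun _ _ => measureReal_le_one) (fun j => ?_)
    (stationaryMean_map_extension_cylinder hμ n)).trans
    (mean_le_of_forall_le fun j hj => ?_))
  · rw [Real.negMulLog, neg_mul]
  · rw [← tsum_measure_fibre (m := meanMeasure hμ) (measurable_codeBlock f n j)]
    exact tsum_congr fun w => ofReal_measureReal
  · rw [← add_assoc, blockEntropy_eq_entropy hμ n]
    refine add_le_add_left (le_trans ?_ (add_le_add_right (entropy_apply_le hμ n) _)) _
    exact entropy_le_add_of_determined (measurable_codeBlock f n j) (measurable_block _)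
      (measurable_pi_apply _) fun x x' => codeBlock_eq_of_block_eq f hj

/-- Concavity makes the mixing free in this direction, so no `log L` appears; the extra letter is
`x_1`. -/
theorem le_blockEntropy_map_extension (hμ : IsAMS μ) (hf : Function.Injective f) (n : ℕ) :
    blockEntropy (stationaryMean μ) n ≤
      blockEntropy (stationaryMean (μ.map (extension f))) (n * L) +
        blockEntropy (stationaryMean μ) 2 := by
  have hmean := mean_entropy_le (L := L)
    (p := fun j w => (meanMeasure hμ).real (codeBlock f n j ⁻¹' {w}))
    (q := fun w => stationaryMean (μ.map (extension f)) (cylinder w))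
    (fun _ _ => measureReal_nonneg) (fun _ _ => measureReal_le_one)
    (stationaryMean_map_extension_cylinder hμ n)
  have hb : ∀ j < L, blockEntropy (stationaryMean μ) n ≤
      entropy (meanMeasure hμ) (codeBlock f n j) + blockEntropy (stationaryMean μ) 2 := by
    intro j hj
    rw [blockEntropy_eq_entropy hμ n, add_comm]
    refine le_trans ?_ (add_le_add_left (entropy_apply_le hμ 0) _)
    refine entropy_le_add_of_determined (measurable_block n) (measurable_pi_apply _)
      (measurable_codeBlock f n j) fun x x' h => ?_
    exact block_eq_of_codeBlock_eq f hf hj (by simpa using h)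
  refine (le_mean_of_forall_le hb).trans ?_
  rw [Finset.sum_add_distrib, mul_add]
  refine add_le_add (hmean.trans (le_of_eq (tsum_congr fun w => ?_)))
    (mean_le_of_forall_le fun _ _ => le_rfl)
  rw [Real.negMulLog, neg_mul]

end BlockEntropy

theorem abs_toReal_sub_toReal_le {a b c : ℝ≥0∞} {r : ℝ} (hr : 0 ≤ r) (ha : a ≠ ⊤) (hb : b ≠ ⊤)
    (hc : c ≠ ⊤) (hab : a ≤ b + (c + ENNReal.ofReal r)) (hba : b ≤ a + (c + ENNReal.ofReal r)) :
    |a.toReal - b.toReal| ≤ c.toReal + r := by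
  have key : ∀ {a b : ℝ≥0∞}, b ≠ ⊤ → a ≤ b + (c + ENNReal.ofReal r) →
      a.toReal ≤ b.toReal + (c.toReal + r) := by
    intro a b hb h
    have hcr : c + ENNReal.ofReal r ≠ ⊤ := ENNReal.add_ne_top.2 ⟨hc, ENNReal.ofReal_ne_top⟩
    have := ENNReal.toReal_mono (ENNReal.add_ne_top.2 ⟨hb, hcr⟩) h
    rwa [ENNReal.toReal_add hb hcr, ENNReal.toReal_add hc ENNReal.ofReal_ne_top,
      ENNReal.toReal_ofReal hr] at this
  rw [abs_le]
  constructor <;> linarith [key hb hab, key ha hba]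

end BlockCoding

theorem mainTheorem10 {X Y : Type*}
    [Countable X] [MeasurableSpace X] [DiscreteMeasurableSpace X]
    [Countable Y] [MeasurableSpace Y] [DiscreteMeasurableSpace Y]
    (μ : Measure (ℤ → X)) [IsProbabilityMeasure μ] (hμ : BlockCoding.IsAMS μ)
    (L : ℕ) [NeZero L] (f : X → Fin L → Y)
    (hf : BlockCoding.PrefixFreeCode (fun x => List.ofFn (f x)))
    (ν : Measure (ℤ → Y)) (hν : ν = μ.map (BlockCoding.extension f)) :
    BlockCoding.IsAMS ν ∧
    ∀ n : ℕ,
      -- both one-sided bounds, in `[0, ∞]`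
      (BlockCoding.blockEntropy (BlockCoding.stationaryMean ν) (n * L) ≤
          BlockCoding.blockEntropy (BlockCoding.stationaryMean μ) n +
            (BlockCoding.blockEntropy (BlockCoding.stationaryMean μ) 2 +
              ENNReal.ofReal (Real.log L))) ∧
      (BlockCoding.blockEntropy (BlockCoding.stationaryMean μ) n ≤
          BlockCoding.blockEntropy (BlockCoding.stationaryMean ν) (n * L) +
            (BlockCoding.blockEntropy (BlockCoding.stationaryMean μ) 2 +
              ENNReal.ofReal (Real.log L))) ∧
      -- when the right-hand side is finite, so are the two entropies, and the bound reads: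
      (BlockCoding.blockEntropy (BlockCoding.stationaryMean μ) 2 ≠ ⊤ →
        BlockCoding.blockEntropy (BlockCoding.stationaryMean μ) n ≠ ⊤ ∧
        BlockCoding.blockEntropy (BlockCoding.stationaryMean ν) (n * L) ≠ ⊤ ∧
        |(BlockCoding.blockEntropy (BlockCoding.stationaryMean ν) (n * L)).toReal -
            (BlockCoding.blockEntropy (BlockCoding.stationaryMean μ) n).toReal| ≤
          (BlockCoding.blockEntropy (BlockCoding.stationaryMean μ) 2).toReal + Real.log L) := by
  subst hν
  have hinj : Function.Injective f := fun x y h => hf.1 (by simp only [h])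
  refine ⟨BlockCoding.isAMS_map_extension f hμ, fun n => ?_⟩
  have hle := BlockCoding.blockEntropy_map_extension_le (f := f) hμ n
  have hge := (BlockCoding.le_blockEntropy_map_extension hμ hinj n).trans
    (add_le_add_right (le_self_add (b := ENNReal.ofReal (Real.log L))) _)
  refine ⟨hle, hge, fun h2 => ?_⟩
  have hn := BlockCoding.blockEntropy_ne_top hμ h2 n
  have hnL := ne_top_of_le_ne_top
    (ENNReal.add_ne_top.2 ⟨hn, ENNReal.add_ne_top.2 ⟨h2, ENNReal.ofReal_ne_top⟩⟩) hle
  exact ⟨hn, hnL, BlockCoding.abs_toReal_sub_toReal_le (Real.log_natCast_nonneg L) hnL hn h2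
    hle hge⟩
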